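/- **Theorem.** Let $\mathcal C$ be a category with finite limits and let $P:\mathcal C^{op}\to \mathsf{InfSl}$ be a lex primary doctrine, i.e. a functor to the category of inf-semilattices (with top element; homomorphisms preserve binary meets and top); write $P_f$ for $P(f)$. Then there is an equivalence of categories $$\mathsf{Reg}(P^{\exists})\;\simeq\;(\mathcal G_P)_{\mathrm{reg/lex}},$$ where the following notation is used. *Category of points.* $\mathcal G_P$ has as objects the pairs $(A,\alpha)$ with $A\in\mathcal C$ and $\alpha\in P(A)$, and as morphisms $(A,\alpha)\to(B,\beta)$ the arrows $f:A\to B$ of $\mathcal C$ with $\alpha\le P_f(\beta)$. It has finite limits. *Full existential completion.* $P^{\exists}(A)$ is the poset reflection of the preorder of pairs $(f:B\to A,\ \alpha\in P(B))$, where $(f:B\to A,\alpha)\le(g:D\to A,\beta)$ if there is $h:B\to D$ with $f=g h$ and $\alpha\le P_h(\beta)$; for $f:A\to B$, the map $P^\exists_f$ sends the class of $(g:D\to B,\beta)$ to the class of $(f^*g,\,P_{g^*f}(\beta))$, where $f^*g:A\times_B D\to A$ and $g^*f:A\times_B D\to D$ are the pullback projections. $P^\exists$ is a full existential doctrine: every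 $P^\exists_f$ has a left adjoint $\exists_f$ (given by postcomposition with $f$), and these satisfy the Beck–Chevalley condition and Frobenius reciprocity. *Regular completion of a full existential doctrine $R$ on $\mathcal C$.* The objects of $\mathsf{Reg}(R)$ are the pairs $(A,\alpha)$ with $\alpha\in R(A)$. An arrow $(A,\alpha)\to(B,\beta)$ is an element $\phi\in R(A\times B)$ such that $\phi\le R_{\pi_A}(\alpha)\wedge R_{\pi_B}(\beta)$, $\alpha\le\exists_{\pi_A}(\phi)$, and $R_{\langle\pi_1,\pi_2\rangle}(\phi)\wedge R_{\langle\pi_1,\pi_3\rangle}(\phi)\le R_{\langle\pi_2,\pi_3\rangle}(\delta_B)$ in $R(A\times B\times B)$, where $\delta_B=\exists_{\langle \mathrm{id},\mathrm{id}\rangle}(\top)$. The composite of $\phi:(A,\alpha)\to(B,\beta)$ and $\psi:(B,\beta)\to(D,\gamma)$ is $\exists_{\langle\pi_1,\pi_3\rangle}\bigl(R_{\langle\pi_1,\pi_2\rangle}(\phi)\wedge R_{\langle\pi_2,\pi_3\rangle}(\psi)\bigr)$, with $\pi_i$ the projections from $A\times B\times D$; the identity on $(A,\alpha)$ is $R_{\pi_1}(\alpha)\wedge\delta_A$.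 *Reg/lex completion of a category $\mathcal D$ with finite limits.* The objects of $\mathcal D_{\mathrm{reg/lex}}$ are the arrows $f:X\to Y$ of $\mathcal D$. An arrow from $f:X\to Y$ to $g:Z\to W$ is an equivalence class $[l]$ of arrows $l:X\to Z$ of $\mathcal D$ with $g\,l\,f_0=g\,l\,f_1$, where $f_0,f_1$ is the kernel pair of $f$, and $[l]=[m]$ if and only if $g\,l=g\,m$; composition and identities are those of $\mathcal D$. -/

import Mathlib

open CategoryTheory CategoryTheory.Limits Opposite

universe w v u

noncomputable section

attribute [local simp] prod.lift_fst prod.lift_snd prod.lift_fst_assoc prod.lift_snd_assoc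
  prod.comp_lift pullback.lift_fst pullback.lift_snd pullback.lift_fst_assoc pullback.lift_snd_assoc

/-- A lex primary doctrine on a category `C` with finite limits: a functor from `Cᵒᵖ` to the
category of inf-semilattices (with top element; morphisms preserve binary meets and top). -/
abbrev LexPrimaryDoctrine (C : Type u) [Category.{v} C] [HasFiniteLimits C] :
    Type (max u v (w + 1)) :=
  Cᵒᵖ ⥤ SemilatInfCat.{w}

namespace LexPrimaryDoctrine

variable {C : Type u} [Category.{v} C] [HasFiniteLimits C] (P : LexPrimaryDoctrine.{w} C)

/-- The fibre `P(A)`. -/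
abbrev Fib (A : C) : Type w := P.obj (op A)

/-- The reindexing map `P_f : P(B) → P(A)` along `f : A ⟶ B`. -/
def pull {A B : C} (f : A ⟶ B) : InfTopHom (P.Fib B) (P.Fib A) := P.map f.op

@[simp]
theorem pull_id {A : C} (α : P.Fib A) : P.pull (𝟙 A) α = α := by
  have h : P.map (𝟙 A).op = 𝟙 _ := P.map_id _
  unfold pull
  rw [h]
  rfl

theorem pull_comp {A B D : C} (f : A ⟶ B) (g : B ⟶ D) (α : P.Fib D) :
    P.pull (f ≫ g) α = P.pull f (P.pull g α) := by
  have h : P.map (f ≫ g).op = P.map g.op ≫ P.map f.op := P.map_comp _ _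
  unfold pull
  rw [h]
  rfl

theorem pull_mono {A B : C} (f : A ⟶ B) {α β : P.Fib B} (h : α ≤ β) :
    P.pull f α ≤ P.pull f β :=
  OrderHomClass.mono (P.pull f) h

/-! ### The category of points -/

/-- Objects of the category of points (Grothendieck construction) of `P`: pairs `(A, α)` with
`α ∈ P(A)`. -/
structure Points where
  base : C
  elt : P.Fib base

variable {P} in
/-- Morphisms `(A, α) ⟶ (B, β)` are the arrows `f : A ⟶ B` with `α ≤ P_f(β)`. -/
@[ext]
structure Points.Hom (X Y : P.Points) where
  hom : X.base ⟶ Y.base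
  le : X.elt ≤ P.pull hom Y.elt

instance : Category P.Points where
  Hom := Points.Hom
  id X := ⟨𝟙 _, by simp⟩
  comp f g := ⟨f.hom ≫ g.hom, by
    rw [pull_comp]
    exact f.le.trans (P.pull_mono _ g.le)⟩
  id_comp f := Points.Hom.ext (Category.id_comp f.hom)
  comp_id f := Points.Hom.ext (Category.comp_id f.hom)
  assoc f g h := Points.Hom.ext (Category.assoc f.hom g.hom h.hom)

namespace Points

variable {P}

@[ext]
theorem hom_ext {X Y : P.Points} {f g : X ⟶ Y} (h : f.hom = g.hom) : f = g := Hom.ext h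

@[simp] theorem id_hom (X : P.Points) : Hom.hom (𝟙 X) = 𝟙 X.base := rfl

@[simp] theorem comp_hom {X Y Z : P.Points} (f : X ⟶ Y) (g : Y ⟶ Z) :
    (f ≫ g).hom = f.hom ≫ g.hom := rfl

instance : HasTerminal P.Points :=
  IsTerminal.hasTerminal (X := (⟨⊤_ C, ⊤⟩ : P.Points))
    (IsTerminal.ofUniqueHom (fun X => ⟨terminal.from _, by simp⟩)
      (fun X m => hom_ext (Subsingleton.elim _ _)))

instance : HasPullbacks P.Points := by
  refine @hasPullbacks_of_hasLimit_cospan _ _ ?_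
  intro X Y Z f g
  let W : P.Points := ⟨pullback f.hom g.hom,
    P.pull (pullback.fst f.hom g.hom) X.elt ⊓ P.pull (pullback.snd f.hom g.hom) Y.elt⟩
  let p : W ⟶ X := ⟨pullback.fst f.hom g.hom, inf_le_left⟩
  let q : W ⟶ Y := ⟨pullback.snd f.hom g.hom, inf_le_right⟩
  have comm : p ≫ f = q ≫ g := hom_ext pullback.condition
  refine ⟨⟨⟨PullbackCone.mk p q comm, PullbackCone.IsLimit.mk comm
    (fun s => ⟨pullback.lift s.fst.hom s.snd.hom (congrArg Hom.hom s.condition), ?_⟩)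
    ?_ ?_ ?_⟩⟩⟩
  · change s.pt.elt ≤ P.pull _ (_ ⊓ _)
    rw [map_inf, ← pull_comp, ← pull_comp, pullback.lift_fst, pullback.lift_snd]
    exact le_inf (Hom.le s.fst) (Hom.le s.snd)
  · intro s
    exact hom_ext (pullback.lift_fst _ _ _)
  · intro s
    exact hom_ext (pullback.lift_snd _ _ _)
  · intro s m h1 h2
    refine hom_ext (pullback.hom_ext ?_ ?_)
    · exact (congrArg Hom.hom h1).trans (pullback.lift_fst _ _ _).symm
    · exact (congrArg Hom.hom h2).trans (pullback.lift_snd _ _ _).symm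

/-- The category of points has finite limits. -/
instance : HasFiniteLimits P.Points := hasFiniteLimits_of_hasTerminal_and_pullbacks

end Points

/-! ### Full existential doctrines -/

/-- `P` is full existential: every reindexing map `P_f` has a left adjoint `∃_f`, and these satisfy
the Beck-Chevalley condition (for all pullback squares) and Frobenius reciprocity. The maps `∃_f`
are uniquely determined by `P`, since the fibres are partially ordered. -/
class FullExistential where
  /-- the left adjoint `∃_f` -/
  ex {A B : C} (f : A ⟶ B) : P.Fib A → P.Fib B
  adj {A B : C} (f : A ⟶ B) : GaloisConnection (ex f) (P.pull f)
  beck_chevalley {W X Y Z : C} {p : W ⟶ X} {q : W ⟶ Y} {f : X ⟶ Z} {g : Y ⟶ Z}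
    (sq : IsPullback p q f g) (α : P.Fib X) : P.pull g (ex f α) = ex q (P.pull p α)
  frobenius {A B : C} (f : A ⟶ B) (α : P.Fib A) (β : P.Fib B) :
    ex f (α ⊓ P.pull f β) = ex f α ⊓ β

theorem le_of_forall_pull {A B : C} {φ ψ : P.Fib (A ⨯ B)}
    (h : ∀ (X : C) (a : X ⟶ A) (b : X ⟶ B),
      P.pull (prod.lift a b) φ ≤ P.pull (prod.lift a b) ψ) : φ ≤ ψ := by
  simpa [prod.lift_fst_snd] using h (A ⨯ B) prod.fst prod.snd

section Regular

variable [FullExistential P]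

/-- The left adjoint `∃_f : P(A) → P(B)` to reindexing along `f : A ⟶ B`. -/
def ex {A B : C} (f : A ⟶ B) (α : P.Fib A) : P.Fib B := FullExistential.ex f α

/-- The equality predicate `δ_A = ∃_{⟨id, id⟩}(⊤) ∈ P(A × A)`. -/
def delta (A : C) : P.Fib (A ⨯ A) := P.ex (prod.lift (𝟙 A) (𝟙 A)) ⊤

theorem le_pull_ex {X A B : C} (f : A ⟶ B) (a : X ⟶ A) (b : X ⟶ B) (h : a ≫ f = b)
    (α : P.Fib A) : P.pull a α ≤ P.pull b (P.ex f α) := by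
  subst h
  rw [pull_comp]
  exact P.pull_mono _ ((FullExistential.adj f).le_u_l α)

theorem pull_ex_inf_le {X A B : C} (f : A ⟶ B) (b : X ⟶ B) (α : P.Fib A) (ξ ζ : P.Fib X)
    (h : ∀ (Y : C) (r : Y ⟶ X) (a : Y ⟶ A), a ≫ f = r ≫ b →
      P.pull a α ⊓ P.pull r ξ ≤ P.pull r ζ) :
    P.pull b (P.ex f α) ⊓ ξ ≤ ζ := by
  unfold ex
  rw [FullExistential.beck_chevalley (IsPullback.of_hasPullback f b),
    ← FullExistential.frobenius]
  exact (FullExistential.adj _).l_le (h _ _ _ pullback.condition)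

theorem pull_ex_le {X A B : C} (f : A ⟶ B) (b : X ⟶ B) (α : P.Fib A) (ζ : P.Fib X)
    (h : ∀ (Y : C) (r : Y ⟶ X) (a : Y ⟶ A), a ≫ f = r ≫ b → P.pull a α ≤ P.pull r ζ) :
    P.pull b (P.ex f α) ≤ ζ := by
  rw [← inf_top_eq (P.pull b _)]
  exact P.pull_ex_inf_le f b α ⊤ ζ fun Y r a e => inf_le_left.trans (h Y r a e)

theorem top_le_delta {X A : C} (a : X ⟶ A) :
    ⊤ ≤ P.pull (prod.lift a a) (P.delta A) := by
  rw [← map_top (P.pull a)]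
  exact P.le_pull_ex _ _ _ (by ext <;> simp) ⊤

theorem delta_inf_le {X A : C} (a b : X ⟶ A) (ξ ζ : P.Fib X)
    (h : ∀ (Y : C) (r : Y ⟶ X), r ≫ a = r ≫ b → P.pull r ξ ≤ P.pull r ζ) :
    P.pull (prod.lift a b) (P.delta A) ⊓ ξ ≤ ζ := by
  refine P.pull_ex_inf_le _ _ _ _ _ fun Y r c e => inf_le_right.trans (h Y r ?_)
  have h1 := congrArg (· ≫ prod.fst) e
  have h2 := congrArg (· ≫ prod.snd) e
  simp only [Category.assoc, prod.lift_fst, prod.lift_snd, Category.comp_id] at h1 h2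
  exact h1.symm.trans h2

/-- Relational composition `∃_{⟨π₁, π₃⟩}(P_{⟨π₁, π₂⟩}(φ) ∧ P_{⟨π₂, π₃⟩}(ψ))`, where
`π₁, π₂, π₃` are the projections from `A × B × D`. -/
def relComp {A B D : C} (φ : P.Fib (A ⨯ B)) (ψ : P.Fib (B ⨯ D)) : P.Fib (A ⨯ D) :=
  P.ex (prod.lift prod.fst (prod.snd ≫ prod.snd) : A ⨯ (B ⨯ D) ⟶ A ⨯ D)
    (P.pull (prod.lift prod.fst (prod.snd ≫ prod.fst)) φ ⊓ P.pull prod.snd ψ)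

theorem le_relComp {X A B D : C} (φ : P.Fib (A ⨯ B)) (ψ : P.Fib (B ⨯ D))
    (a : X ⟶ A) (b : X ⟶ B) (d : X ⟶ D) :
    P.pull (prod.lift a b) φ ⊓ P.pull (prod.lift b d) ψ ≤
      P.pull (prod.lift a d) (P.relComp φ ψ) := by
  have h := P.le_pull_ex (prod.lift prod.fst (prod.snd ≫ prod.snd) : A ⨯ (B ⨯ D) ⟶ A ⨯ D)
    (prod.lift a (prod.lift b d)) (prod.lift a d) (by ext <;> simp)
    (P.pull (prod.lift prod.fst (prod.snd ≫ prod.fst)) φ ⊓ P.pull prod.snd ψ)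
  rw [map_inf, ← pull_comp, ← pull_comp] at h
  simpa [relComp] using h

theorem relComp_inf_le {X A B D : C} (φ : P.Fib (A ⨯ B)) (ψ : P.Fib (B ⨯ D))
    (a : X ⟶ A) (d : X ⟶ D) (ξ ζ : P.Fib X)
    (h : ∀ (Y : C) (r : Y ⟶ X) (b : Y ⟶ B),
      P.pull (prod.lift (r ≫ a) b) φ ⊓ P.pull (prod.lift b (r ≫ d)) ψ ⊓ P.pull r ξ ≤
        P.pull r ζ) :
    P.pull (prod.lift a d) (P.relComp φ ψ) ⊓ ξ ≤ ζ := by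
  refine P.pull_ex_inf_le _ _ _ _ _ fun Y r c e => ?_
  have h1 := congrArg (· ≫ prod.fst) e
  have h2 := congrArg (· ≫ prod.snd) e
  simp only [Category.assoc, prod.lift_fst, prod.lift_snd] at h1 h2
  have := h Y r (c ≫ prod.snd ≫ prod.fst)
  rw [← h1, ← h2] at this
  rw [map_inf, ← pull_comp, ← pull_comp]
  convert this using 4
  · ext
    all_goals simp
  · congr 1
    ext <;> simp

theorem relComp_le {X A B D : C} (φ : P.Fib (A ⨯ B)) (ψ : P.Fib (B ⨯ D))
    (a : X ⟶ A) (d : X ⟶ D) (ζ : P.Fib X)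
    (h : ∀ (Y : C) (r : Y ⟶ X) (b : Y ⟶ B),
      P.pull (prod.lift (r ≫ a) b) φ ⊓ P.pull (prod.lift b (r ≫ d)) ψ ≤ P.pull r ζ) :
    P.pull (prod.lift a d) (P.relComp φ ψ) ≤ ζ := by
  rw [← inf_top_eq (P.pull _ _)]
  exact P.relComp_inf_le φ ψ a d ⊤ ζ fun Y r b => inf_le_left.trans (h Y r b)

/-! ### The regular completion of a full existential doctrine -/

/-- Objects of the regular completion `Reg(P)`: pairs `(A, α)` with `α ∈ P(A)`. -/
structure Reg where
  base : C
  elt : P.Fib base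

variable {P} in
/-- Arrows `(A, α) ⟶ (B, β)` of `Reg(P)`: the elements `φ ∈ P(A × B)` which are total functional
relations from `α` to `β`. In `functional`, the projections are those from `A × B × B`. -/
@[ext]
structure Reg.Hom (X Y : P.Reg) where
  rel : P.Fib (X.base ⨯ Y.base)
  rel_le : rel ≤ P.pull prod.fst X.elt ⊓ P.pull prod.snd Y.elt
  total : X.elt ≤ P.ex prod.fst rel
  functional :
    P.pull (prod.lift prod.fst (prod.snd ≫ prod.fst) :
        X.base ⨯ (Y.base ⨯ Y.base) ⟶ X.base ⨯ Y.base) rel ⊓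
      P.pull (prod.lift prod.fst (prod.snd ≫ prod.snd)) rel ≤
    P.pull prod.snd (P.delta Y.base)

namespace Reg

variable {P}

theorem Hom.le_left {X Y : P.Reg} (φ : Hom X Y) {T : C} (a : T ⟶ X.base) (b : T ⟶ Y.base) :
    P.pull (prod.lift a b) φ.rel ≤ P.pull a X.elt := by
  have h := P.pull_mono (prod.lift a b) (φ.rel_le.trans inf_le_left)
  rwa [← pull_comp, prod.lift_fst] at h

theorem Hom.le_right {X Y : P.Reg} (φ : Hom X Y) {T : C} (a : T ⟶ X.base) (b : T ⟶ Y.base) :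
    P.pull (prod.lift a b) φ.rel ≤ P.pull b Y.elt := by
  have h := P.pull_mono (prod.lift a b) (φ.rel_le.trans inf_le_right)
  rwa [← pull_comp, prod.lift_snd] at h

theorem Hom.le_delta {X Y : P.Reg} (φ : Hom X Y) {T : C} (a : T ⟶ X.base)
    (b c : T ⟶ Y.base) :
    P.pull (prod.lift a b) φ.rel ⊓ P.pull (prod.lift a c) φ.rel ≤
      P.pull (prod.lift b c) (P.delta Y.base) := by
  have h := P.pull_mono (prod.lift a (prod.lift b c)) φ.functional
  rw [map_inf, ← pull_comp, ← pull_comp, ← pull_comp] at h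
  simpa using h

theorem Hom.elim {X Y : P.Reg} (φ : Hom X Y) {T : C} (a : T ⟶ X.base) (ξ ζ : P.Fib T)
    (hξ : ξ ≤ P.pull a X.elt)
    (h : ∀ (S : C) (r : S ⟶ T) (b : S ⟶ Y.base),
      P.pull (prod.lift (r ≫ a) b) φ.rel ⊓ P.pull r ξ ≤ P.pull r ζ) : ξ ≤ ζ := by
  refine (le_inf (hξ.trans (P.pull_mono a φ.total)) le_rfl).trans ?_
  refine P.pull_ex_inf_le _ _ _ _ _ fun S r c e => ?_
  have := h S r (c ≫ prod.snd)
  rw [← e] at this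
  convert this using 3
  congr 1
  ext <;> simp

theorem functional_of {A B : C} (φ : P.Fib (A ⨯ B))
    (h : ∀ (T : C) (a : T ⟶ A) (b c : T ⟶ B),
      P.pull (prod.lift a b) φ ⊓ P.pull (prod.lift a c) φ ≤
        P.pull (prod.lift b c) (P.delta B)) :
    P.pull (prod.lift prod.fst (prod.snd ≫ prod.fst) : A ⨯ (B ⨯ B) ⟶ A ⨯ B) φ ⊓
      P.pull (prod.lift prod.fst (prod.snd ≫ prod.snd)) φ ≤ P.pull prod.snd (P.delta B) := by
  have := h (A ⨯ (B ⨯ B)) prod.fst (prod.snd ≫ prod.fst) (prod.snd ≫ prod.snd)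
  convert this using 2
  congr 1
  ext <;> simp

/-- The identity on `(A, α)` is `P_{π₁}(α) ∧ δ_A`. -/
def idHom (X : P.Reg) : Hom X X where
  rel := P.pull prod.fst X.elt ⊓ P.delta X.base
  rel_le := by
    refine le_inf inf_le_left ?_
    rw [inf_comm]
    have := P.delta_inf_le (prod.fst : X.base ⨯ X.base ⟶ X.base) prod.snd
      (P.pull prod.fst X.elt) (P.pull prod.snd X.elt)
      (fun Y r e => by rw [← pull_comp, ← pull_comp, e])
    simpa [prod.lift_fst_snd] using this
  total := by
    have := P.le_pull_ex (prod.fst : X.base ⨯ X.base ⟶ X.base)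
      (prod.lift (𝟙 _) (𝟙 _)) (𝟙 _) (by simp) (P.pull prod.fst X.elt ⊓ P.delta X.base)
    rw [pull_id, map_inf, ← pull_comp, prod.lift_fst, pull_id] at this
    exact (le_inf le_rfl (le_top.trans (P.top_le_delta _))).trans this
  functional := by
    refine functional_of _ fun T a b c => ?_
    rw [map_inf, map_inf]
    refine (inf_le_inf inf_le_right inf_le_right).trans ?_
    refine P.delta_inf_le _ _ _ _ fun Y r e => ?_
    rw [← pull_comp, ← pull_comp, prod.comp_lift, prod.comp_lift, e]

/-- Composition of arrows of `Reg(P)` is relational composition. -/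
def compHom {X Y Z : P.Reg} (φ : Hom X Y) (ψ : Hom Y Z) : Hom X Z where
  rel := P.relComp φ.rel ψ.rel
  rel_le := by
    have := P.relComp_le φ.rel ψ.rel prod.fst prod.snd
      (P.pull prod.fst X.elt ⊓ P.pull prod.snd Z.elt) (fun T r b => by
        rw [map_inf, ← pull_comp, ← pull_comp]
        exact inf_le_inf (φ.le_left _ _) (ψ.le_right _ _))
    simpa [prod.lift_fst_snd] using this
  total := by
    refine φ.elim (𝟙 _) _ _ (by simp) fun S r b => ?_
    refine inf_le_left.trans ?_
    refine ψ.elim b _ _ (φ.le_right _ _) fun S' r' d => ?_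
    rw [inf_comm, ← pull_comp, prod.comp_lift]
    refine (P.le_relComp _ _ _ _ _).trans ?_
    rw [← pull_comp]
    exact P.le_pull_ex _ _ _ (by simp) _
  functional := by
    refine functional_of _ fun T a d d' => ?_
    refine P.relComp_inf_le _ _ _ _ _ _ fun S r b => ?_
    rw [inf_comm, ← pull_comp, prod.comp_lift]
    refine P.relComp_inf_le _ _ _ _ _ _ fun S' r' b' => ?_
    rw [map_inf, ← pull_comp, ← pull_comp, ← pull_comp, ← pull_comp]
    simp only [prod.comp_lift, ← Category.assoc]
    -- `φ(a, b')`, `ψ(b', d')`, `φ(a, b)` and `ψ(b, d)` give `δ(b, b')`, hence `δ(d, d')`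
    have key : ∀ (U : C) (a : U ⟶ X.base) (b b' : U ⟶ Y.base) (d d' : U ⟶ Z.base),
        (P.pull (prod.lift a b') φ.rel ⊓ P.pull (prod.lift b' d') ψ.rel) ⊓
          (P.pull (prod.lift a b) φ.rel ⊓ P.pull (prod.lift b d) ψ.rel) ≤
        P.pull (prod.lift d d') (P.delta Z.base) := by
      intro U a b b' d d'
      refine (le_inf ((le_inf (inf_le_right.trans inf_le_left)
        (inf_le_left.trans inf_le_left)).trans (φ.le_delta a b b')) (le_inf
          (inf_le_right.trans inf_le_right) (inf_le_left.trans inf_le_right))).trans ?_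
      refine P.delta_inf_le _ _ _ _ fun V s e => ?_
      rw [map_inf, ← pull_comp, ← pull_comp, ← pull_comp]
      simp only [prod.comp_lift]
      rw [← e]
      exact ψ.le_delta _ _ _
    exact key _ _ _ _ _ _

theorem idHom_comp {X Y : P.Reg} (φ : Hom X Y) : compHom (idHom X) φ = φ := by
  refine Hom.ext (le_antisymm ?_ ?_)
  · refine P.le_of_forall_pull fun T a b => P.relComp_le _ _ _ _ _ fun S r c => ?_
    simp only [idHom, map_inf]
    refine (inf_le_inf_right _ inf_le_right).trans ?_
    refine P.delta_inf_le _ _ _ _ fun V s e => ?_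
    rw [← pull_comp, ← pull_comp, ← pull_comp]
    simp only [prod.comp_lift]
    rw [← e]
    simp
  · refine P.le_of_forall_pull fun T a b => ?_
    refine le_trans ?_ (P.le_relComp _ _ a a b)
    refine le_inf ?_ le_rfl
    simp only [idHom, map_inf]
    refine le_inf ?_ (le_top.trans (P.top_le_delta a))
    rw [← pull_comp, prod.lift_fst]
    exact φ.le_left _ _

theorem comp_idHom {X Y : P.Reg} (φ : Hom X Y) : compHom φ (idHom Y) = φ := by
  refine Hom.ext (le_antisymm ?_ ?_)
  · refine P.le_of_forall_pull fun T a b => P.relComp_le _ _ _ _ _ fun S r c => ?_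
    simp only [idHom, map_inf]
    refine (inf_le_inf_left _ inf_le_right).trans ?_
    rw [inf_comm]
    refine P.delta_inf_le _ _ _ _ fun V s e => ?_
    rw [← pull_comp, ← pull_comp, ← pull_comp]
    simp only [prod.comp_lift]
    rw [e]
    simp
  · refine P.le_of_forall_pull fun T a b => ?_
    refine le_trans ?_ (P.le_relComp _ _ a b b)
    refine le_inf le_rfl ?_
    simp only [idHom, map_inf]
    refine le_inf ?_ (le_top.trans (P.top_le_delta b))
    rw [← pull_comp, prod.lift_fst]
    exact φ.le_right _ _

theorem compHom_assoc {X Y Z W : P.Reg} (φ : Hom X Y) (ψ : Hom Y Z) (χ : Hom Z W) :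
    compHom (compHom φ ψ) χ = compHom φ (compHom ψ χ) := by
  refine Hom.ext (le_antisymm ?_ ?_)
  · refine P.le_of_forall_pull fun T a d => P.relComp_le _ _ _ _ _ fun S r c => ?_
    refine P.relComp_inf_le _ _ _ _ _ _ fun S' r' b => ?_
    rw [← pull_comp, ← pull_comp, ← pull_comp, inf_assoc]
    simp only [prod.comp_lift, Category.assoc]
    exact (inf_le_inf_left _ (P.le_relComp _ _ _ _ _)).trans (P.le_relComp _ _ _ _ _)
  · refine P.le_of_forall_pull fun T a d => P.relComp_le _ _ _ _ _ fun S r b => ?_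
    rw [inf_comm]
    refine P.relComp_inf_le _ _ _ _ _ _ fun S' r' c => ?_
    rw [← pull_comp, ← pull_comp, ← pull_comp, inf_comm, ← inf_assoc]
    simp only [prod.comp_lift, Category.assoc]
    exact (inf_le_inf_right _ (P.le_relComp _ _ _ _ _)).trans (P.le_relComp _ _ _ _ _)

end Reg

/-- The regular completion `Reg(P)` of a full existential doctrine `P`. -/
instance : Category P.Reg where
  Hom := Reg.Hom
  id := Reg.idHom
  comp := Reg.compHom
  id_comp := Reg.idHom_comp
  comp_id := Reg.comp_idHom
  assoc := Reg.compHom_assoc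

end Regular

/-! ### The full existential completion -/

/-- Representatives of elements of the fibre over `A` of the full existential completion: pairs of
an arrow `f : B ⟶ A` and an element `α ∈ P(B)`. -/
structure ExRep (A : C) where
  dom : C
  hom : dom ⟶ A
  elt : P.Fib dom

/-- `(f : B ⟶ A, α) ≤ (g : D ⟶ A, β)` if there is `h : B ⟶ D` with `f = g ∘ h` and
`α ≤ P_h(β)`. -/
instance (A : C) : Preorder (P.ExRep A) where
  le x y := ∃ h : x.dom ⟶ y.dom, h ≫ y.hom = x.hom ∧ x.elt ≤ P.pull h y.elt
  le_refl x := ⟨𝟙 _, by simp, by simp⟩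
  le_trans := by
    rintro x y z ⟨h, h1, h2⟩ ⟨k, k1, k2⟩
    refine ⟨h ≫ k, by rw [Category.assoc, k1, h1], ?_⟩
    rw [pull_comp]
    exact h2.trans (P.pull_mono h k2)

variable {P} in
theorem ExRep.le_def {A : C} {x y : P.ExRep A} :
    x ≤ y ↔ ∃ h : x.dom ⟶ y.dom, h ≫ y.hom = x.hom ∧ x.elt ≤ P.pull h y.elt := Iff.rfl

/-- The fibre over `A` of the full existential completion: the poset reflection of the preorder
`ExRep A`. -/
abbrev ExFib (A : C) := Antisymmetrization (P.ExRep A) (· ≤ ·)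

namespace ExRep

variable {P}

/-- Reindexing by pullback. -/
abbrev pull {A B : C} (f : A ⟶ B) (x : P.ExRep B) : P.ExRep A :=
  ⟨pullback f x.hom, pullback.fst f x.hom, P.pull (pullback.snd f x.hom) x.elt⟩

/-- Binary meets, by pullback over `A`. -/
abbrev inf {A : C} (x y : P.ExRep A) : P.ExRep A :=
  ⟨pullback x.hom y.hom, pullback.fst x.hom y.hom ≫ x.hom,
    P.pull (pullback.fst x.hom y.hom) x.elt ⊓ P.pull (pullback.snd x.hom y.hom) y.elt⟩

/-- The top element `(id_A, ⊤)`. -/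
abbrev top (A : C) : P.ExRep A := ⟨A, 𝟙 A, ⊤⟩

/-- The left adjoint to reindexing, by postcomposition. -/
abbrev ex {A B : C} (f : A ⟶ B) (x : P.ExRep A) : P.ExRep B := ⟨x.dom, x.hom ≫ f, x.elt⟩

theorem inf_le_left {A : C} (x y : P.ExRep A) : inf x y ≤ x :=
  ⟨pullback.fst _ _, rfl, _root_.inf_le_left⟩

theorem inf_le_right {A : C} (x y : P.ExRep A) : inf x y ≤ y :=
  ⟨pullback.snd _ _, pullback.condition.symm, _root_.inf_le_right⟩

theorem le_inf {A : C} {x y z : P.ExRep A} (hy : z ≤ x) (hz : z ≤ y) : z ≤ inf x y := by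
  obtain ⟨h, h1, h2⟩ := hy
  obtain ⟨k, k1, k2⟩ := hz
  refine ⟨pullback.lift h k (h1.trans k1.symm), ?_, ?_⟩
  · simp [inf, h1]
  · simp only [inf, map_inf, ← pull_comp, pullback.lift_fst, pullback.lift_snd]
    exact _root_.le_inf h2 k2

theorem le_top {A : C} (x : P.ExRep A) : x ≤ top A := ⟨x.hom, by simp [top], by simp [top]⟩

theorem le_pull_iff {A B : C} (f : A ⟶ B) (x : P.ExRep A) (y : P.ExRep B) :
    x ≤ pull f y ↔
      ∃ h : x.dom ⟶ y.dom, h ≫ y.hom = x.hom ≫ f ∧ x.elt ≤ P.pull h y.elt := by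
  constructor
  · rintro ⟨h, h1, h2⟩
    refine ⟨h ≫ pullback.snd _ _, ?_, ?_⟩
    · rw [Category.assoc, ← pullback.condition, ← h1]
      simp [pull]
    · rw [pull_comp]
      exact h2
  · rintro ⟨h, h1, h2⟩
    refine ⟨pullback.lift x.hom h h1.symm, by simp [pull], ?_⟩
    simp only [pull, ← pull_comp, pullback.lift_snd]
    exact h2

theorem ex_le_iff {A B : C} (f : A ⟶ B) (x : P.ExRep A) (y : P.ExRep B) :
    ex f x ≤ y ↔ x ≤ pull f y := (le_pull_iff f x y).symm

theorem pull_mono {A B : C} (f : A ⟶ B) : Monotone (pull (P := P) f) := fun x y hxy => by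
  rw [← ex_le_iff]
  exact le_trans ((ex_le_iff f _ _).2 le_rfl) hxy

theorem ex_mono {A B : C} (f : A ⟶ B) : Monotone (ex (P := P) f) := fun x y hxy => by
  rw [ex_le_iff]
  exact le_trans hxy ((ex_le_iff f _ _).1 le_rfl)

end ExRep

instance (A : C) : SemilatticeInf (P.ExFib A) where
  inf := Quotient.map₂ ExRep.inf fun _ _ hx _ _ hy =>
    ⟨ExRep.le_inf ((ExRep.inf_le_left _ _).trans hx.1) ((ExRep.inf_le_right _ _).trans hy.1),
      ExRep.le_inf ((ExRep.inf_le_left _ _).trans hx.2) ((ExRep.inf_le_right _ _).trans hy.2)⟩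
  inf_le_left := by
    rintro ⟨x⟩ ⟨y⟩
    exact ExRep.inf_le_left x y
  inf_le_right := by
    rintro ⟨x⟩ ⟨y⟩
    exact ExRep.inf_le_right x y
  le_inf := by
    rintro ⟨x⟩ ⟨y⟩ ⟨z⟩ h1 h2
    exact ExRep.le_inf (x := y) (y := z) (z := x) h1 h2

instance (A : C) : OrderTop (P.ExFib A) where
  top := toAntisymmetrization _ (ExRep.top A)
  le_top := by
    rintro ⟨x⟩
    exact ExRep.le_top x

namespace ExFib

variable {P}

/-- The map on poset reflections induced by a monotone map. -/
def map {A B : C} (F : P.ExRep A → P.ExRep B) (hF : Monotone F) : P.ExFib A → P.ExFib B :=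
  Quotient.map F fun _ _ h => ⟨hF h.1, hF h.2⟩

/-- Reindexing `[g, β] ↦ [f^* g, P_{g^* f}(β)]`. -/
def pull {A B : C} (f : A ⟶ B) : InfTopHom (P.ExFib B) (P.ExFib A) where
  toFun := map (ExRep.pull f) (ExRep.pull_mono f)
  map_inf' := by
    rintro ⟨x⟩ ⟨y⟩
    refine le_antisymm (le_inf ?_ ?_) ?_
    · exact ExRep.pull_mono f (ExRep.inf_le_left x y)
    · exact ExRep.pull_mono f (ExRep.inf_le_right x y)
    · refine (ExRep.ex_le_iff f _ (ExRep.inf x y)).1 (ExRep.le_inf ?_ ?_)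
      · exact (ExRep.ex_le_iff f _ x).2 (ExRep.inf_le_left _ _)
      · exact (ExRep.ex_le_iff f _ y).2 (ExRep.inf_le_right _ _)
  map_top' := top_unique ((ExRep.ex_le_iff f (ExRep.top A) (ExRep.top B)).1 (ExRep.le_top _))

/-- The map `[g, α] ↦ [f ∘ g, α]`. -/
def ex {A B : C} (f : A ⟶ B) : P.ExFib A → P.ExFib B := map (ExRep.ex f) (ExRep.ex_mono f)

theorem gc {A B : C} (f : A ⟶ B) : GaloisConnection (ex (P := P) f) (pull f) := by
  rintro ⟨x⟩ ⟨y⟩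
  exact ExRep.ex_le_iff f x y

theorem ex_id (A : C) (x : P.ExFib A) : ex (𝟙 A) x = x := by
  obtain ⟨x⟩ := x
  change toAntisymmetrization _ (ExRep.ex (𝟙 A) x) = toAntisymmetrization _ x
  simp [ExRep.ex]

theorem ex_comp {A B D : C} (f : A ⟶ B) (g : B ⟶ D) (x : P.ExFib A) :
    ex (f ≫ g) x = ex g (ex f x) := by
  obtain ⟨x⟩ := x
  change toAntisymmetrization _ (ExRep.ex (f ≫ g) x) =
    toAntisymmetrization _ (ExRep.ex g (ExRep.ex f x))
  simp [ExRep.ex]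

end ExFib

/-- The full existential completion `P^∃` of a lex primary doctrine `P`. -/
def exCompletion : LexPrimaryDoctrine.{max u v w} C where
  obj A := SemilatInfCat.of (P.ExFib A.unop)
  map f := (ExFib.pull f.unop : InfTopHom _ _)
  map_id A := by
    refine InfTopHom.ext fun x => eq_of_forall_le_iff fun y => ?_
    change y ≤ ExFib.pull (𝟙 A.unop) x ↔ y ≤ x
    rw [← ExFib.gc (𝟙 A.unop) y x, ExFib.ex_id]
  map_comp {X Y Z} f g := by
    refine InfTopHom.ext fun x => eq_of_forall_le_iff fun y => ?_
    change y ≤ ExFib.pull (g.unop ≫ f.unop) x ↔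
      y ≤ ExFib.pull g.unop (ExFib.pull f.unop x)
    rw [← ExFib.gc, ← ExFib.gc, ← ExFib.gc, ExFib.ex_comp]

/-- The full existential completion is full existential. -/
instance : FullExistential P.exCompletion where
  ex f := ExFib.ex f
  adj f := ExFib.gc f
  beck_chevalley {W X Y Z p q f g} sq := by
    rintro ⟨x⟩
    refine le_antisymm ?_ ?_
    · change ExRep.pull g (ExRep.ex f x) ≤ ExRep.ex q (ExRep.pull p x)
      refine ⟨pullback.lift
        (sq.lift (pullback.snd _ _ ≫ x.hom) (pullback.fst g (x.hom ≫ f))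
          (by rw [pullback.condition, Category.assoc]))
        (pullback.snd g (x.hom ≫ f)) (by simp), ?_, ?_⟩
      · simp [ExRep.pull, ExRep.ex]
      · change P.pull _ _ ≤ P.pull _ (P.pull _ _)
        rw [← pull_comp, pullback.lift_snd]
    · refine (ExFib.gc (P := P) q _ _).2 ?_
      change ExRep.pull p x ≤ ExRep.pull q (ExRep.pull g (ExRep.ex f x))
      rw [← ExRep.ex_le_iff, ← ExRep.ex_le_iff]
      refine ⟨pullback.snd _ _, ?_, le_rfl⟩
      simp only [ExRep.ex, ExRep.pull, Category.assoc]
      rw [← pullback.condition_assoc, sq.w]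
  frobenius {A B} f := by
    rintro ⟨x⟩ ⟨y⟩
    refine le_antisymm (le_inf ?_ ?_) ?_
    · exact ExRep.ex_mono f (ExRep.inf_le_left x _)
    · exact (ExRep.ex_le_iff f _ y).2 (ExRep.inf_le_right _ _)
    · change ExRep.inf (ExRep.ex f x) y ≤ ExRep.ex f (ExRep.inf x (ExRep.pull f y))
      refine ⟨pullback.lift (pullback.fst (x.hom ≫ f) y.hom)
        (pullback.lift (pullback.fst (x.hom ≫ f) y.hom ≫ x.hom) (pullback.snd _ _)
          (by rw [Category.assoc, pullback.condition])) (by simp), ?_, ?_⟩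
      · simp [ExRep.ex, ExRep.inf]
      · change P.pull _ _ ⊓ P.pull _ _ ≤ P.pull _ (P.pull _ _ ⊓ P.pull _ (P.pull _ _))
        rw [map_inf, ← pull_comp, ← pull_comp, ← pull_comp, pullback.lift_fst]
        simp only [pullback.lift_snd]
        exact le_rfl

end LexPrimaryDoctrine

/-! ### The reg/lex completion of a category with finite limits -/

/-- Objects of the reg/lex completion of `D`: the arrows `f : X ⟶ Y` of `D`. -/
structure RegLex (D : Type u) [Category.{v} D] [HasFiniteLimits D] where
  dom : D
  cod : D
  hom : dom ⟶ cod

namespace RegLex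

variable {D : Type u} [Category.{v} D] [HasFiniteLimits D]

/-- Representatives of arrows from `f : X ⟶ Y` to `g : Z ⟶ W`: the arrows `l : X ⟶ Z` such that
`g ∘ l` coequalizes the kernel pair of `f`. -/
structure PreHom (f g : RegLex D) where
  hom : f.dom ⟶ g.dom
  w : pullback.fst f.hom f.hom ≫ hom ≫ g.hom = pullback.snd f.hom f.hom ≫ hom ≫ g.hom

theorem PreHom.apply {f g : RegLex D} (l : PreHom f g) {T : D} (a b : T ⟶ f.dom)
    (h : a ≫ f.hom = b ≫ f.hom) : a ≫ l.hom ≫ g.hom = b ≫ l.hom ≫ g.hom := by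
  have := congrArg (pullback.lift a b h ≫ ·) l.w
  simpa only [pullback.lift_fst_assoc, pullback.lift_snd_assoc] using this

/-- Two representatives `l`, `m` give the same arrow when `g ∘ l = g ∘ m`. -/
instance PreHom.setoid (f g : RegLex D) : Setoid (PreHom f g) where
  r l m := l.hom ≫ g.hom = m.hom ≫ g.hom
  iseqv := ⟨fun _ => rfl, fun h => h.symm, fun h k => h.trans k⟩

/-- Composition of representatives is composition in `D`. -/
def PreHom.comp {f g h : RegLex D} (l : PreHom f g) (m : PreHom g h) : PreHom f h where
  hom := l.hom ≫ m.hom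
  w := by
    have := m.apply (pullback.fst f.hom f.hom ≫ l.hom) (pullback.snd f.hom f.hom ≫ l.hom)
      (by simpa only [Category.assoc] using l.w)
    simpa only [Category.assoc] using this

/-- The reg/lex completion of a category with finite limits. -/
instance : Category (RegLex D) where
  Hom f g := _root_.Quotient (PreHom.setoid f g)
  id f := _root_.Quotient.mk _ ⟨𝟙 _, by simpa using pullback.condition⟩
  comp {f g h} := _root_.Quotient.map₂ PreHom.comp (by
    intro l l' hl m m' hm
    change (l.hom ≫ m.hom) ≫ h.hom = (l'.hom ≫ m'.hom) ≫ h.hom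
    rw [Category.assoc, Category.assoc, m.apply _ _ hl]
    exact congrArg (l'.hom ≫ ·) hm)
  id_comp := by
    rintro f g ⟨l⟩
    refine _root_.Quotient.sound ?_
    change (𝟙 _ ≫ l.hom) ≫ g.hom = l.hom ≫ g.hom
    rw [Category.id_comp]
  comp_id := by
    rintro f g ⟨l⟩
    refine _root_.Quotient.sound ?_
    change (l.hom ≫ 𝟙 _) ≫ g.hom = l.hom ≫ g.hom
    rw [Category.comp_id]
  assoc := by
    rintro f g h k ⟨l⟩ ⟨m⟩ ⟨n⟩
    refine _root_.Quotient.sound ?_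
    change ((l.hom ≫ m.hom) ≫ n.hom) ≫ k.hom = (l.hom ≫ m.hom ≫ n.hom) ≫ k.hom
    rw [Category.assoc l.hom]

end RegLex

end

/-!
An element of `P^∃(A)` is the class of an arrow `f` into `A` from a point `X`; let `X` force
`φ(f)` when this class lies below `φ`. Reindexing is substitution, equality is forced only when
the two arrows agree, and, the crucial fact, a forced existential has a witness defined on `X`
itself. So a functional relation out of the image of `f : X ⟶ Y` is the graph of a unique arrow
`c` out of `X`, and `c` identifies whatever `f` does; it lands in the image of `g : Z ⟶ W` exactly
when `c = l ≫ g` for some `l : X ⟶ Z`. These are the arrows of the reg/lex completion.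
-/

noncomputable section

namespace LexPrimaryDoctrine

variable {C : Type u} [Category.{v} C] [HasFiniteLimits C] {P : LexPrimaryDoctrine.{w} C}

theorem pull_lift_delta_inf_le [FullExistential P] {T A B : C} (a : T ⟶ A) (b c : T ⟶ B)
    (φ : P.Fib (A ⨯ B)) :
    P.pull (prod.lift b c) (P.delta B) ⊓ P.pull (prod.lift a b) φ ≤
      P.pull (prod.lift a c) φ := by
  refine P.delta_inf_le _ _ _ _ fun S s hs => ?_
  rw [← pull_comp, ← pull_comp, prod.comp_lift, prod.comp_lift, hs]

/-- Totality of `φ` provides a value, which functionality of `ψ` identifies with every value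
of `ψ`. -/
theorem Reg.Hom.eq_of_le [FullExistential P] {X Y : P.Reg} {φ ψ : Reg.Hom X Y}
    (h : φ.rel ≤ ψ.rel) : φ = ψ := by
  refine Reg.Hom.ext (le_antisymm h (P.le_of_forall_pull fun T a b => ?_))
  refine φ.elim a _ _ (ψ.le_left a b) fun S r c => ?_
  rw [← pull_comp, ← pull_comp, prod.comp_lift]
  have hδ : P.pull (prod.lift (r ≫ a) c) φ.rel ⊓ P.pull (prod.lift (r ≫ a) (r ≫ b)) ψ.rel ≤
      P.pull (prod.lift c (r ≫ b)) (P.delta Y.base) :=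
    (inf_le_inf_right _ (P.pull_mono _ h)).trans (ψ.le_delta _ _ _)
  exact (le_inf hδ inf_le_left).trans (pull_lift_delta_inf_le _ _ _ _)

namespace exCompletion

/-- The element of `P^∃(A)` represented by an arrow `f` into `A` and an element of `P` over the
domain of `f`; the two pieces of data on the domain are bundled into a point `X`. -/
def mk {A : C} (X : P.Points) (f : X.base ⟶ A) : P.exCompletion.Fib A :=
  toAntisymmetrization (· ≤ ·) (⟨X.base, f, X.elt⟩ : P.ExRep A)

theorem exists_mk_eq {A : C} (φ : P.exCompletion.Fib A) :
    ∃ (X : P.Points) (f : X.base ⟶ A), mk X f = φ := by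
  obtain ⟨⟨B, f, α⟩⟩ := φ
  exact ⟨⟨B, α⟩, f, rfl⟩

theorem mk_le_mk_iff {A : C} {X Y : P.Points} {f : X.base ⟶ A} {g : Y.base ⟶ A} :
    mk X f ≤ mk Y g ↔ ∃ h : X ⟶ Y, h.hom ≫ g = f :=
  ⟨fun ⟨h, hg, hle⟩ => ⟨⟨h, hle⟩, hg⟩, fun ⟨h, hg⟩ => ⟨h.hom, hg, Points.Hom.le h⟩⟩

theorem mk_comp_le {A : C} {X Y : P.Points} (h : X ⟶ Y) (g : Y.base ⟶ A) :
    mk X (h.hom ≫ g) ≤ mk Y g :=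
  mk_le_mk_iff.2 ⟨h, rfl⟩

theorem mk_lift_le_mk_lift_iff {A B : C} {X Y : P.Points} {a : X.base ⟶ A} {b : X.base ⟶ B}
    {c : Y.base ⟶ A} {d : Y.base ⟶ B} :
    mk X (prod.lift a b) ≤ mk Y (prod.lift c d) ↔
      ∃ h : X ⟶ Y, h.hom ≫ c = a ∧ h.hom ≫ d = b := by
  simp only [mk_le_mk_iff, prod.comp_lift, Limits.prod.hom_ext_iff, prod.lift_fst, prod.lift_snd]

theorem le_of_forall_mk_le {A : C} {φ ψ : P.exCompletion.Fib A}
    (h : ∀ (X : P.Points) (f : X.base ⟶ A), mk X f ≤ φ → mk X f ≤ ψ) : φ ≤ ψ := by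
  obtain ⟨X, f, rfl⟩ := exists_mk_eq φ
  exact h X f le_rfl

theorem mk_le_pull_iff {A B : C} {X : P.Points} {f : X.base ⟶ A} (u : A ⟶ B)
    {φ : P.exCompletion.Fib B} :
    mk X f ≤ P.exCompletion.pull u φ ↔ mk X (f ≫ u) ≤ φ :=
  (ExFib.gc u (mk X f) φ).symm

theorem mk_le_ex_iff {A B : C} {X : P.Points} {f : X.base ⟶ B} (u : A ⟶ B)
    {φ : P.exCompletion.Fib A} :
    mk X f ≤ P.exCompletion.ex u φ ↔ ∃ g : X.base ⟶ A, g ≫ u = f ∧ mk X g ≤ φ := by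
  obtain ⟨Y, k, rfl⟩ := exists_mk_eq φ
  change mk X f ≤ mk Y (k ≫ u) ↔ _
  simp only [mk_le_mk_iff]
  constructor
  · rintro ⟨h, rfl⟩
    exact ⟨h.hom ≫ k, Category.assoc _ _ _, h, rfl⟩
  · rintro ⟨_, rfl, h, rfl⟩
    exact ⟨h, (Category.assoc _ _ _).symm⟩

theorem mk_le_delta_iff {A : C} {X : P.Points} {a b : X.base ⟶ A} :
    mk X (prod.lift a b) ≤ P.exCompletion.delta A ↔ a = b := by
  simp only [delta, mk_le_ex_iff, le_top, and_true, prod.comp_lift, Category.comp_id,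
    Limits.prod.hom_ext_iff, prod.lift_fst, prod.lift_snd, exists_eq_left]

theorem mk_le_relComp {A B D : C} {φ : P.exCompletion.Fib (A ⨯ B)}
    {ψ : P.exCompletion.Fib (B ⨯ D)} {X : P.Points} {a : X.base ⟶ A} (b : X.base ⟶ B)
    {d : X.base ⟶ D} (hφ : mk X (prod.lift a b) ≤ φ) (hψ : mk X (prod.lift b d) ≤ ψ) :
    mk X (prod.lift a d) ≤ P.exCompletion.relComp φ ψ := by
  refine (mk_le_ex_iff _).2 ⟨prod.lift a (prod.lift b d), ?_, le_inf ?_ ?_⟩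
  · simp only [prod.comp_lift, prod.lift_fst, prod.lift_snd, prod.lift_snd_assoc]
  · simpa only [mk_le_pull_iff, prod.comp_lift, prod.lift_fst, prod.lift_snd_assoc] using hφ
  · simpa only [mk_le_pull_iff, prod.lift_snd] using hψ

section FunctionalRelations

variable {Y Z : P.exCompletion.Reg} {X : P.Points} {a : X.base ⟶ Y.base} {b c : X.base ⟶ Z.base}

theorem exists_mk_lift_le_rel (φ : Reg.Hom Y Z) (ha : mk X a ≤ Y.elt) :
    ∃ b : X.base ⟶ Z.base, mk X (prod.lift a b) ≤ φ.rel := by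
  obtain ⟨g, rfl, hg⟩ := (mk_le_ex_iff _).1 (ha.trans φ.total)
  exact ⟨g ≫ prod.snd, by rwa [← prod.comp_lift, prod.lift_fst_snd, Category.comp_id]⟩

theorem mk_le_elt_of_mk_lift_le_rel (φ : Reg.Hom Y Z) (hb : mk X (prod.lift a b) ≤ φ.rel) :
    mk X b ≤ Z.elt := by
  simpa only [mk_le_pull_iff, prod.lift_snd] using hb.trans (φ.rel_le.trans inf_le_right)

theorem eq_of_mk_lift_le_rel (φ : Reg.Hom Y Z) (hb : mk X (prod.lift a b) ≤ φ.rel)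
    (hc : mk X (prod.lift a c) ≤ φ.rel) : b = c := by
  have hbc : mk X (𝟙 X.base) ≤ P.exCompletion.pull (prod.lift b c) (P.exCompletion.delta _) := by
    refine le_trans (le_inf ?_ ?_) (φ.le_delta a b c)
    · rwa [mk_le_pull_iff, Category.id_comp]
    · rwa [mk_le_pull_iff, Category.id_comp]
  rwa [mk_le_pull_iff, Category.id_comp, mk_le_delta_iff] at hbc

end FunctionalRelations

/-- The functional relation `[⟨f, c⟩, ξ]` out of the image `(A, [f, ξ])` of an arrow `f : X ⟶ A`,
where `X` carries `ξ`. It exhibits the image as a quotient of `X`: an arrow `c` into `B` which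
identifies all generalized elements that `f` identifies descends to it. -/
def imageDesc {A : C} {X : P.Points} (f : X.base ⟶ A) {B : P.exCompletion.Reg}
    (c : X.base ⟶ B.base) (hc : mk X c ≤ B.elt)
    (w : ∀ (T : P.Points) (s t : T ⟶ X), s.hom ≫ f = t.hom ≫ f → s.hom ≫ c = t.hom ≫ c) :
    Reg.Hom (⟨A, mk X f⟩ : P.exCompletion.Reg) B where
  rel := mk X (prod.lift f c)
  rel_le := by
    simpa only [le_inf_iff, mk_le_pull_iff, prod.lift_fst, prod.lift_snd, le_rfl, true_and]
      using hc
  total := (mk_le_ex_iff _).2 ⟨prod.lift f c, prod.lift_fst _ _, le_rfl⟩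
  functional := by
    refine Reg.functional_of _ fun T a b b' => le_of_forall_mk_le fun S u hu => ?_
    simp only [le_inf_iff, mk_le_pull_iff, prod.comp_lift, mk_lift_le_mk_lift_iff] at hu
    obtain ⟨⟨s, hsa, hsb⟩, t, hta, htb⟩ := hu
    rw [mk_le_pull_iff, prod.comp_lift, mk_le_delta_iff, ← hsb, ← htb]
    exact w S s t (hsa.trans hta.symm)

end exCompletion

open exCompletion

/-- The functor sending an arrow `f : (X, ξ) ⟶ (Y, υ)` of the category of points to its image
`(Y, [f, ξ])`, and an arrow `[l]` from `f` to `g` to the functional relation induced by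
`l ≫ g`. -/
def imageFunctor (P : LexPrimaryDoctrine.{w} C) : RegLex P.Points ⥤ P.exCompletion.Reg where
  obj f := ⟨f.cod.base, mk f.dom f.hom.hom⟩
  map {f g} := _root_.Quotient.lift
    (fun l => imageDesc f.hom.hom (l.hom.hom ≫ g.hom.hom) (mk_comp_le _ _) fun _ s t hst =>
      congrArg Points.Hom.hom (l.apply s t (Points.hom_ext hst)))
    fun l m (hlm : l.hom ≫ g.hom = m.hom ≫ g.hom) =>
      Reg.Hom.ext (congrArg (mk f.dom <| prod.lift f.hom.hom <| Points.Hom.hom ·) hlm)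
  map_id f := by
    refine Reg.Hom.eq_of_le (le_inf ((mk_le_pull_iff _).2 ?_) (mk_le_delta_iff.2 ?_))
    · rw [prod.lift_fst]
    · exact (Category.id_comp _).symm
  map_comp := by
    rintro f g h ⟨l⟩ ⟨m⟩
    refine Reg.Hom.eq_of_le (mk_le_relComp (l.hom.hom ≫ g.hom.hom) le_rfl ?_)
    exact mk_lift_le_mk_lift_iff.2 ⟨l.hom, rfl, (Category.assoc _ _ _).symm⟩

instance : (imageFunctor P).Faithful where
  map_injective {f g} := by
    rintro ⟨l⟩ ⟨m⟩ hlm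
    refine _root_.Quotient.sound (Points.hom_ext ?_)
    exact eq_of_mk_lift_le_rel _ le_rfl (congrArg Reg.Hom.rel hlm).ge

instance : (imageFunctor P).Full where
  map_surjective {f g} φ := by
    obtain ⟨c, hc⟩ := exists_mk_lift_le_rel φ le_rfl
    obtain ⟨l, rfl⟩ := mk_le_mk_iff.1 (mk_le_elt_of_mk_lift_le_rel φ hc)
    have hl {T : P.Points} (s : T ⟶ f.dom) :
        mk T (prod.lift (s ≫ f.hom).hom (s ≫ l ≫ g.hom).hom) ≤ φ.rel :=
      (mk_lift_le_mk_lift_iff.2 ⟨s, rfl, rfl⟩).trans hc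
    have w : pullback.fst f.hom f.hom ≫ l ≫ g.hom = pullback.snd f.hom f.hom ≫ l ≫ g.hom :=
      Points.hom_ext <| eq_of_mk_lift_le_rel φ (hl _) <| by
        rw [pullback.condition]
        exact hl _
    exact ⟨_root_.Quotient.mk _ ⟨l, w⟩, Reg.Hom.eq_of_le hc⟩

instance : (imageFunctor P).EssSurj where
  mem_essImage := by
    rintro ⟨A, φ⟩
    obtain ⟨X, f, rfl⟩ := exists_mk_eq φ
    exact ⟨⟨X, ⟨A, ⊤⟩, ⟨f, le_top.trans (map_top _).ge⟩⟩, ⟨Iso.refl _⟩⟩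

instance : (imageFunctor P).IsEquivalence where

end LexPrimaryDoctrine

end

theorem mainTheorem9 {C : Type u} [Category.{v} C] [HasFiniteLimits C]
    (P : LexPrimaryDoctrine.{w} C) :
    Nonempty (P.exCompletion.Reg ≌ RegLex P.Points) :=
  ⟨P.imageFunctor.asEquivalence.symm⟩
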